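/- Let $C_{0,r}^\infty(\mathbb{R}^2)$ be the space of real-valued, compactly supported, radial $C^\infty$ functions on $\mathbb{R}^2$ (radial: $\varphi(x)=\varphi(y)$ whenever $|x|=|y|$), and let $\mathcal{H}_r^{2,4}(\mathbb{R}^2)$ be its completion with respect to the norm $$\|\varphi\|_{2,4}=\|\nabla\varphi\|_{L^2(\mathbb{R}^2)}+\|\varphi\|_{L^4(\mathbb{R}^2)}.$$ An element of $\mathcal{H}_r^{2,4}(\mathbb{R}^2)$, represented by a $\|\cdot\|_{2,4}$-Cauchy sequence of test functions, is regarded as the function that is the limit of this sequence in $L^4(\mathbb{R}^2)$. Then for every $q\in(4,\infty)$ the space $\mathcal{H}_r^{2,4}(\mathbb{R}^2)$ is compactly embedded into $L^q(\mathbb{R}^2)$: there is an injective, continuous, compact linear map $\iota:\mathcal{H}_r^{2,4}(\mathbb{R}^2)\to L^q(\mathbb{R}^2)$ that sends every $\varphi\in C_{0,r}^\infty(\mathbb{R}^2)$ to (the class of) $\varphi$ itself and every $u\in\mathcal{H}_r^{2,4}(\mathbb{R}^2)$ to the function $u$, i.e. $\iota(u)=u$ almost everywhere. -/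

import Mathlib

open MeasureTheory Gradient
open scoped ENNReal ContDiff

noncomputable section

/-- The Euclidean plane `ℝ²`. -/
abbrev Plane : Type := EuclideanSpace ℝ (Fin 2)

/-- The real vector space of radial functions in `C₀^∞(ℝ²)`: real-valued smooth compactly supported
functions on the plane whose value at `x` depends only on `|x|`. -/
def radialTestSubmodule : Submodule ℝ (Plane → ℝ) where
  carrier := {φ | ContDiff ℝ ∞ φ ∧ HasCompactSupport φ ∧ ∀ x y : Plane, ‖x‖ = ‖y‖ → φ x = φ y}
  zero_mem' := ⟨contDiff_const, HasCompactSupport.zero, fun _ _ _ => rfl⟩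
  add_mem' := fun {φ ψ} hφ hψ =>
    ⟨hφ.1.add hψ.1, hφ.2.1.add hψ.2.1, fun x y h => by
      simp only [Pi.add_apply, hφ.2.2 x y h, hψ.2.2 x y h]⟩
  smul_mem' := fun c φ hφ =>
    ⟨contDiff_const.smul hφ.1, hφ.2.1.smul_left (f := fun _ => c), fun x y h => by
      simp only [Pi.smul_apply, hφ.2.2 x y h]⟩

/-- The type of radial functions in `C₀^∞(ℝ²)`. It is a copy of the submodule above that does not
inherit the topology of pointwise convergence; it is normed by `‖∇φ‖₂ + ‖φ‖₄` below. -/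
def RadialTest : Type := ↥radialTestSubmodule

namespace RadialTest

instance : AddCommGroup RadialTest := inferInstanceAs (AddCommGroup ↥radialTestSubmodule)

instance : Module ℝ RadialTest := inferInstanceAs (Module ℝ ↥radialTestSubmodule)

/-- The underlying function of a radial test function. -/
def toFun (φ : RadialTest) : Plane → ℝ := Subtype.val φ

instance : CoeFun RadialTest (fun _ => Plane → ℝ) := ⟨toFun⟩

theorem contDiff (φ : RadialTest) : ContDiff ℝ ∞ φ := φ.2.1

theorem hasCompactSupport (φ : RadialTest) : HasCompactSupport φ := φ.2.2.1

theorem radial (φ : RadialTest) {x y : Plane} (h : ‖x‖ = ‖y‖) : φ x = φ y := φ.2.2.2 x y h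

theorem toFun_zero : toFun 0 = 0 := rfl

theorem toFun_add (φ ψ : RadialTest) : toFun (φ + ψ) = toFun φ + toFun ψ := rfl

theorem toFun_smul (c : ℝ) (φ : RadialTest) : toFun (c • φ) = c • toFun φ := rfl

theorem toFun_injective : Function.Injective toFun := Subtype.val_injective

theorem differentiable (φ : RadialTest) : Differentiable ℝ φ :=
  φ.contDiff.differentiable (by simp)

theorem gradient_add (φ ψ : RadialTest) : ∇ (toFun (φ + ψ)) = ∇ (toFun φ) + ∇ (toFun ψ) := by
  funext x
  simp only [gradient, toFun_add, Pi.add_apply]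
  rw [fderiv_add (φ.differentiable x) (ψ.differentiable x), map_add]

theorem gradient_smul (c : ℝ) (φ : RadialTest) : ∇ (toFun (c • φ)) = c • ∇ (toFun φ) := by
  funext x
  simp only [gradient, toFun_smul, Pi.smul_apply]
  rw [fderiv_const_smul (φ.differentiable x), map_smulₛₗ]
  simp

theorem memLp (φ : RadialTest) (p : ℝ≥0∞) : MemLp φ p (volume : Measure Plane) :=
  φ.contDiff.continuous.memLp_of_hasCompactSupport φ.hasCompactSupport

theorem memLp_gradient (φ : RadialTest) (p : ℝ≥0∞) :
    MemLp (∇ (toFun φ)) p (volume : Measure Plane) := by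
  refine Continuous.memLp_of_hasCompactSupport ?_ ?_
  · exact (InnerProductSpace.toDual ℝ Plane).symm.continuous.comp
      (φ.contDiff.continuous_fderiv (by simp))
  · exact (φ.hasCompactSupport.fderiv (𝕜 := ℝ)).comp_left
      (g := (InnerProductSpace.toDual ℝ Plane).symm) (map_zero _)

/-- The norm `‖φ‖_{2,4} = ‖∇φ‖₂ + ‖φ‖₄`. -/
def norm24 (φ : RadialTest) : ℝ :=
  (eLpNorm (∇ (toFun φ)) 2 (volume : Measure Plane)).toReal +
    (eLpNorm (toFun φ) 4 (volume : Measure Plane)).toReal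

theorem norm24_smul (c : ℝ) (φ : RadialTest) : norm24 (c • φ) = |c| * norm24 φ := by
  rw [norm24, gradient_smul, toFun_smul]
  simp only [norm24, eLpNorm_const_smul, ENNReal.toReal_mul, toReal_enorm, Real.norm_eq_abs]
  ring

theorem norm24_add_le (φ ψ : RadialTest) : norm24 (φ + ψ) ≤ norm24 φ + norm24 ψ := by
  have h1 : (eLpNorm (∇ (toFun (φ + ψ))) 2 (volume : Measure Plane)).toReal ≤
      (eLpNorm (∇ (toFun φ)) 2 (volume : Measure Plane)).toReal +
        (eLpNorm (∇ (toFun ψ)) 2 (volume : Measure Plane)).toReal := by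
    rw [gradient_add, ← ENNReal.toReal_add (φ.memLp_gradient 2).2.ne (ψ.memLp_gradient 2).2.ne]
    exact ENNReal.toReal_mono
      (ENNReal.add_ne_top.2 ⟨(φ.memLp_gradient 2).2.ne, (ψ.memLp_gradient 2).2.ne⟩)
      (eLpNorm_add_le (φ.memLp_gradient 2).1 (ψ.memLp_gradient 2).1 (by norm_num))
  have h2 : (eLpNorm (toFun (φ + ψ)) 4 (volume : Measure Plane)).toReal ≤
      (eLpNorm (toFun φ) 4 (volume : Measure Plane)).toReal +
        (eLpNorm (toFun ψ) 4 (volume : Measure Plane)).toReal := by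
    rw [toFun_add, ← ENNReal.toReal_add (φ.memLp 4).2.ne (ψ.memLp 4).2.ne]
    exact ENNReal.toReal_mono (ENNReal.add_ne_top.2 ⟨(φ.memLp 4).2.ne, (ψ.memLp 4).2.ne⟩)
      (eLpNorm_add_le (φ.memLp 4).1 (ψ.memLp 4).1 (by norm_num))
  simp only [norm24]
  linarith

theorem eq_zero_of_norm24_eq_zero (φ : RadialTest) (h : norm24 φ = 0) : φ = 0 := by
  have h4 : (eLpNorm (toFun φ) 4 (volume : Measure Plane)).toReal = 0 := by
    have h1 : 0 ≤ (eLpNorm (∇ (toFun φ)) 2 (volume : Measure Plane)).toReal :=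
      ENNReal.toReal_nonneg
    have h2 : 0 ≤ (eLpNorm (toFun φ) 4 (volume : Measure Plane)).toReal :=
      ENNReal.toReal_nonneg
    simp only [norm24] at h
    linarith
  have h5 : eLpNorm (toFun φ) 4 (volume : Measure Plane) = 0 :=
    (ENNReal.toReal_eq_zero_iff _).1 h4 |>.resolve_right (φ.memLp 4).2.ne
  rw [eLpNorm_eq_zero_iff (φ.memLp 4).1 (by norm_num)] at h5
  exact toFun_injective (Measure.eq_of_ae_eq h5 φ.contDiff.continuous continuous_const)

instance : NormedAddCommGroup RadialTest :=
  AddGroupNorm.toNormedAddCommGroup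
    { toFun := norm24
      map_zero' := by simpa using norm24_smul 0 0
      add_le' := norm24_add_le
      neg' := fun φ => by simpa using norm24_smul (-1) φ
      eq_zero_of_map_eq_zero' := eq_zero_of_norm24_eq_zero }

theorem norm_def (φ : RadialTest) :
    ‖φ‖ = (eLpNorm (∇ (toFun φ)) 2 (volume : Measure Plane)).toReal +
      (eLpNorm (toFun φ) 4 (volume : Measure Plane)).toReal := rfl

instance : NormedSpace ℝ RadialTest where
  norm_smul_le c φ := (norm24_smul c φ).le

instance fact_one_le_four : Fact ((1 : ℝ≥0∞) ≤ 4) := ⟨by norm_num⟩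

/-- The inclusion of the radial test functions into `L⁴(ℝ²)`, as a linear map. -/
def inclL4Linear : RadialTest →ₗ[ℝ] Lp ℝ 4 (volume : Measure Plane) where
  toFun φ := (φ.memLp 4).toLp φ
  map_add' φ ψ := MemLp.toLp_add (φ.memLp 4) (ψ.memLp 4)
  map_smul' c φ := MemLp.toLp_const_smul c (φ.memLp 4)

/-- The inclusion of the radial test functions into `L⁴(ℝ²)`. -/
def inclL4 : RadialTest →L[ℝ] Lp ℝ 4 (volume : Measure Plane) :=
  inclL4Linear.mkContinuous 1 fun φ => by
    have h : ‖inclL4Linear φ‖ = (eLpNorm (toFun φ) 4 (volume : Measure Plane)).toReal :=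
      Lp.norm_toLp _ (φ.memLp 4)
    rw [one_mul, h, norm_def]
    exact le_add_of_nonneg_left ENNReal.toReal_nonneg

end RadialTest

/-- The space `ℋ_r^{2,4}(ℝ²)`: the completion of the radial functions in `C₀^∞(ℝ²)` with respect
to the norm `‖∇φ‖₂ + ‖φ‖₄`. -/
abbrev RadialH24 : Type := UniformSpace.Completion RadialTest

namespace RadialH24

/-- The continuous linear map `ℋ_r^{2,4}(ℝ²) → L⁴(ℝ²)` extending the inclusion of test functions.
It sends the class of a Cauchy sequence of test functions to its limit in `L⁴(ℝ²)`, that is, an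
element of the completion to the function that it represents. -/
def toL4 : RadialH24 →L[ℝ] Lp ℝ 4 (volume : Measure Plane) :=
  RadialTest.inclL4.extend UniformSpace.Completion.toComplL

theorem toL4_coe (φ : RadialTest) : toL4 (φ : RadialH24) = (φ.memLp 4).toLp φ :=
  ContinuousLinearMap.extend_eq RadialTest.inclL4
    (e := (UniformSpace.Completion.toComplL : RadialTest →L[ℝ] RadialH24))
    UniformSpace.Completion.denseRange_coe
    (UniformSpace.Completion.isUniformInducing_coe RadialTest) φ

end RadialH24

end

/-!
Write `f` for the radial profile of a radial test function `φ`, so that `φ(x) = f(|x|)`. In polar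
coordinates, up to the factor `2π`, the norm controls `∫ t f'(t)² dt` and `∫ t f(t)⁴ dt`. The
Cauchy–Schwarz inequality then gives two pointwise bounds:

* `|f(r) - f(s)| ≤ ‖φ‖ √(log (r/s))` for `0 < s ≤ r` (`RadialTest.abs_profile_sub_le`),
* `|f(r)| ≤ C r^{-1/3} ‖φ‖` (`RadialTest.abs_profile_le`).

By the first, `φ` grows at most like `√(log (1/|x|))` at the origin, so its `L^q` norm over small balls
is uniformly small (`RadialTest.eLpNorm_ball_le`). By the second, together with the bound in `L⁴` and
`q > 4`, its `L^q` norm outside large balls is uniformly small (`RadialTest.eLpNorm_compl_ball_le`). In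
between, by the first bound again, `φ` is uniformly close to a function that is constant on each of
finitely many geometric shells. Thus the inclusion of the test functions into `L^q` is continuous, and
it is a limit in operator norm of finite-rank operators (`RadialTest.exists_finiteDim_approx`). Both
facts pass to the completion and give a compact operator (`RadialH24.isCompactOperator_of_coe`).

The values of the extended map agree almost everywhere with the limits in `L⁴`, because both are limits
in measure (`RadialH24.ae_eq_toL4`). Injectivity thus reduces to that of the map into `L⁴`, that is, to
the closability of the gradient: if `φₙ → 0` in `L⁴` and `∇φₙ → G` in `L²`, integration by parts
against test functions shows `G = 0` (`RadialH24.toL4_injective`).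
-/

/-! ### Profiles of radial test functions -/

/-- The Cauchy–Schwarz inequality on an interval, with a weight. -/
theorem sq_intervalIntegral_mul_le {a b : ℝ} (hab : a ≤ b) {w u v : ℝ → ℝ}
    (hw : ContinuousOn w (Set.Icc a b)) (hu : ContinuousOn u (Set.Icc a b))
    (hv : ContinuousOn v (Set.Icc a b)) (hw0 : ∀ t ∈ Set.Icc a b, 0 ≤ w t) :
    (∫ t in a..b, w t * (u t * v t)) ^ 2 ≤
      (∫ t in a..b, w t * u t ^ 2) * ∫ t in a..b, w t * v t ^ 2 := by
  rw [← Set.uIcc_of_le hab] at hw hu hv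
  have i1 : IntervalIntegrable (fun t => w t * (u t * v t)) volume a b :=
    (hw.mul (hu.mul hv)).intervalIntegrable
  have i2 : IntervalIntegrable (fun t => w t * u t ^ 2) volume a b :=
    (hw.mul (hu.pow 2)).intervalIntegrable
  have i3 : IntervalIntegrable (fun t => w t * v t ^ 2) volume a b :=
    (hw.mul (hv.pow 2)).intervalIntegrable
  -- `∫ w (x u + v)²` is a nonnegative quadratic polynomial in `x`, so its discriminant is `≤ 0`.
  have key : ∀ x : ℝ, 0 ≤ (∫ t in a..b, w t * u t ^ 2) * (x * x) +
      (2 * ∫ t in a..b, w t * (u t * v t)) * x + ∫ t in a..b, w t * v t ^ 2 := by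
    intro x
    have h0 : 0 ≤ ∫ t in a..b, w t * (x * u t + v t) ^ 2 :=
      intervalIntegral.integral_nonneg hab fun t ht => mul_nonneg (hw0 t ht) (sq_nonneg _)
    have h1 : ∫ t in a..b, w t * (x * u t + v t) ^ 2 = ∫ t in a..b,
        ((w t * u t ^ 2) * (x * x) + (w t * (u t * v t)) * (2 * x) + w t * v t ^ 2) :=
      intervalIntegral.integral_congr fun t _ => by ring
    rw [h1, intervalIntegral.integral_add ((i2.mul_const _).add (i1.mul_const _)) i3,
      intervalIntegral.integral_add (i2.mul_const _) (i1.mul_const _),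
      intervalIntegral.integral_mul_const, intervalIntegral.integral_mul_const] at h0
    linarith
  have h := discrim_le_zero key
  rw [discrim] at h
  linarith

namespace RadialTest

/-- The radial profile `t ↦ φ (t e₁)` of a radial test function. It is defined on all of `ℝ` (where it
is even), so that its smoothness is plain smoothness on the line. -/
noncomputable def profile (φ : RadialTest) (t : ℝ) : ℝ := φ (t • EuclideanSpace.single 0 1)

theorem profile_eq (φ : RadialTest) {x : Plane} {t : ℝ} (h : ‖x‖ = |t|) : profile φ t = φ x :=
  φ.radial (by rw [norm_smul]; simp [h])

theorem profile_norm (φ : RadialTest) (x : Plane) : profile φ ‖x‖ = φ x :=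
  φ.profile_eq (by simp)

theorem profile_add (φ ψ : RadialTest) (t : ℝ) :
    profile (φ + ψ) t = profile φ t + profile ψ t := rfl

theorem profile_smul (c : ℝ) (φ : RadialTest) (t : ℝ) : profile (c • φ) t = c * profile φ t := rfl

theorem contDiff_profile (φ : RadialTest) : ContDiff ℝ ∞ (profile φ) :=
  φ.contDiff.comp (contDiff_id.smul contDiff_const)

theorem hasCompactSupport_profile (φ : RadialTest) : HasCompactSupport (profile φ) := by
  obtain ⟨R, hR⟩ := φ.hasCompactSupport.isCompact.isBounded.subset_closedBall (0 : Plane)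
  refine HasCompactSupport.of_support_subset_isCompact (isCompact_closedBall (0 : ℝ) R) ?_
  intro t ht
  have := hR (subset_tsupport _ (show t • EuclideanSpace.single 0 1 ∈ Function.support φ from ht))
  simpa [norm_smul] using this

theorem continuous_deriv_profile (φ : RadialTest) : Continuous (deriv (profile φ)) :=
  φ.contDiff_profile.continuous_deriv (by simp)

theorem hasDerivAt_profile (φ : RadialTest) (t : ℝ) :
    HasDerivAt (profile φ) (deriv (profile φ) t) t :=
  (φ.contDiff_profile.differentiable (by simp) t).hasDerivAt

/-- The radial derivative at `x` is at most `|∇φ(x)|`: it is the derivative of `φ` in the direction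
`x / |x|`. -/
theorem abs_deriv_profile_norm_le (φ : RadialTest) {x : Plane} (hx : x ≠ 0) :
    |deriv (profile φ) ‖x‖| ≤ ‖∇ (toFun φ) x‖ := by
  have hx' : ‖x‖ ≠ 0 := norm_ne_zero_iff.2 hx
  set u : Plane := ‖x‖⁻¹ • x with hu
  have hun : ‖u‖ = 1 := by simp [hu, norm_smul, hx']
  have hxu : ‖x‖ • u = x := by simp [hu, smul_smul, hx']
  have h1 : profile φ = fun t : ℝ => toFun φ (t • u) := by
    funext t
    exact φ.profile_eq (by simp [norm_smul, hun])
  have h2 : HasDerivAt (fun t : ℝ => toFun φ (t • u)) (fderiv ℝ (toFun φ) x u) ‖x‖ := by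
    have h3 : HasFDerivAt (toFun φ) (fderiv ℝ (toFun φ) x) (‖x‖ • u) := by
      rw [hxu]; exact (φ.differentiable x).hasFDerivAt
    have h4 : HasDerivAt (fun t : ℝ => t • u) u ‖x‖ := by
      simpa using (hasDerivAt_id ‖x‖).smul_const u
    exact h3.comp_hasDerivAt _ h4
  rw [h1, h2.deriv, gradient, LinearIsometryEquiv.norm_map, ← Real.norm_eq_abs]
  simpa [hun] using (fderiv ℝ (toFun φ) x).le_opNorm u

end RadialTest

/-- Integration in polar coordinates, with the factor `2π ≥ 1` dropped. -/
theorem setIntegral_Ioi_mul_le_integral_norm {g : ℝ → ℝ} (hg : ∀ t, 0 ≤ g t) :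
    ∫ t in Set.Ioi (0 : ℝ), t * g t ≤ ∫ x : Plane, g ‖x‖ := by
  have h := integral_fun_norm_addHaar (volume : Measure Plane) g
  have h0 : 0 ≤ ∫ t in Set.Ioi (0 : ℝ), t * g t :=
    setIntegral_nonneg measurableSet_Ioi fun t ht => mul_nonneg (le_of_lt ht) (hg t)
  have hb : (volume : Measure Plane).real (Metric.ball 0 1) = Real.pi := by
    rw [Measure.real, EuclideanSpace.volume_ball_fin_two]
    simp [Real.pi_nonneg]
  rw [hb] at h
  simp only [finrank_euclideanSpace_fin, Nat.add_one_sub_one, pow_one, smul_eq_mul, nsmul_eq_mul,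
    Nat.cast_ofNat] at h
  rw [h]
  nlinarith [Real.pi_gt_three]

theorem integral_norm_pow_eq_toReal_eLpNorm_pow {E : Type*} [NormedAddCommGroup E] {g : Plane → E}
    {n : ℕ} (hn : n ≠ 0) (hg : MemLp g n (volume : Measure Plane)) :
    ∫ x, ‖g x‖ ^ n = (eLpNorm g n (volume : Measure Plane)).toReal ^ n := by
  have hi : 0 ≤ ∫ x, ‖g x‖ ^ n := integral_nonneg fun x => by positivity
  rw [hg.eLpNorm_eq_integral_rpow_norm (by exact_mod_cast hn) (by simp),
    ENNReal.toReal_ofReal (by positivity)]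
  simp only [ENNReal.toReal_natCast, Real.rpow_natCast]
  exact (Real.rpow_inv_natCast_pow hi hn).symm

/-- The moment of a nonnegative function over an interval in `(0, ∞)` is at most that over the whole
half-line. -/
theorem intervalIntegral_le_setIntegral_Ioi {g : ℝ → ℝ} (hg : Continuous g)
    (hgs : HasCompactSupport g) (hg0 : ∀ t, 0 ≤ g t) {a b : ℝ} (ha : 0 < a) (hab : a ≤ b) :
    ∫ t in a..b, t * g t ≤ ∫ t in Set.Ioi (0 : ℝ), t * g t := by
  rw [intervalIntegral.integral_of_le hab]
  refine setIntegral_mono_set ?_ ?_ ?_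
  · exact ((continuous_id.mul hg).integrable_of_hasCompactSupport hgs.mul_left).integrableOn
  · filter_upwards [ae_restrict_mem measurableSet_Ioi] with t ht
    exact mul_nonneg (le_of_lt ht) (hg0 t)
  · exact LE.le.eventuallyLE fun t (ht : t ∈ Set.Ioc a b) => lt_trans ha ht.1

namespace RadialTest

theorem norm_gradient_le (φ : RadialTest) :
    (eLpNorm (∇ (toFun φ)) 2 (volume : Measure Plane)).toReal ≤ ‖φ‖ := by
  rw [norm_def]; exact le_add_of_nonneg_right ENNReal.toReal_nonneg

theorem norm_four_le (φ : RadialTest) :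
    (eLpNorm (toFun φ) 4 (volume : Measure Plane)).toReal ≤ ‖φ‖ := by
  rw [norm_def]; exact le_add_of_nonneg_left ENNReal.toReal_nonneg

theorem intervalIntegral_deriv_profile_sq_le (φ : RadialTest) {a b : ℝ} (ha : 0 < a)
    (hab : a ≤ b) : ∫ t in a..b, t * deriv (profile φ) t ^ 2 ≤ ‖φ‖ ^ 2 := by
  have hs : HasCompactSupport fun t => deriv (profile φ) t ^ 2 :=
    φ.hasCompactSupport_profile.deriv.comp_left (g := fun y : ℝ => y ^ 2) (by simp)
  have hG : MemLp (∇ (toFun φ)) (2 : ℕ) (volume : Measure Plane) := φ.memLp_gradient _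
  calc ∫ t in a..b, t * deriv (profile φ) t ^ 2
      ≤ ∫ t in Set.Ioi (0 : ℝ), t * deriv (profile φ) t ^ 2 :=
        intervalIntegral_le_setIntegral_Ioi (φ.continuous_deriv_profile.pow 2) hs
          (fun t => sq_nonneg _) ha hab
    _ ≤ ∫ x : Plane, deriv (profile φ) ‖x‖ ^ 2 :=
        setIntegral_Ioi_mul_le_integral_norm (g := fun t => deriv (profile φ) t ^ 2)
          fun t => sq_nonneg _
    _ ≤ ∫ x : Plane, ‖∇ (toFun φ) x‖ ^ 2 := by
        refine integral_mono_of_nonneg (ae_of_all _ fun x => sq_nonneg _) ?_ ?_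
        · exact hG.integrable_norm_pow (by norm_num)
        · filter_upwards [Measure.ae_ne volume (0 : Plane)] with x hx
          rw [← sq_abs]
          exact pow_le_pow_left₀ (abs_nonneg _) (φ.abs_deriv_profile_norm_le hx) 2
    _ ≤ ‖φ‖ ^ 2 := by
        rw [integral_norm_pow_eq_toReal_eLpNorm_pow two_ne_zero hG]
        exact pow_le_pow_left₀ ENNReal.toReal_nonneg φ.norm_gradient_le 2

theorem intervalIntegral_profile_pow_four_le (φ : RadialTest) {a b : ℝ} (ha : 0 < a)
    (hab : a ≤ b) : ∫ t in a..b, t * profile φ t ^ 4 ≤ ‖φ‖ ^ 4 := by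
  have hs : HasCompactSupport fun t => profile φ t ^ 4 :=
    φ.hasCompactSupport_profile.comp_left (g := fun y : ℝ => y ^ 4) (by simp)
  have h0 : ∀ y : ℝ, 0 ≤ y ^ 4 := fun y => by positivity
  calc ∫ t in a..b, t * profile φ t ^ 4
      ≤ ∫ t in Set.Ioi (0 : ℝ), t * profile φ t ^ 4 :=
        intervalIntegral_le_setIntegral_Ioi (φ.contDiff_profile.continuous.pow 4) hs
          (fun t => h0 _) ha hab
    _ ≤ ∫ x : Plane, profile φ ‖x‖ ^ 4 :=
        setIntegral_Ioi_mul_le_integral_norm (g := fun t => profile φ t ^ 4) fun t => h0 _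
    _ = ∫ x : Plane, ‖toFun φ x‖ ^ 4 := by
        refine integral_congr_ae (ae_of_all _ fun x => ?_)
        simp only [profile_norm, Real.norm_eq_abs]
        exact ((by decide : Even 4).pow_abs _).symm
    _ ≤ ‖φ‖ ^ 4 := by
        rw [integral_norm_pow_eq_toReal_eLpNorm_pow four_ne_zero (φ.memLp _)]
        exact pow_le_pow_left₀ ENNReal.toReal_nonneg φ.norm_four_le 4

/-- The profile is Hölder continuous of order `1/2` in the variable `log r`, from Cauchy–Schwarz
applied to `f(r) - f(s) = ∫ t · f'(t) · t⁻¹ dt`. -/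
theorem sq_profile_sub_le (φ : RadialTest) {s r : ℝ} (hs : 0 < s) (hsr : s ≤ r) :
    (profile φ r - profile φ s) ^ 2 ≤ ‖φ‖ ^ 2 * Real.log (r / s) := by
  have hpos : ∀ t ∈ Set.Icc s r, 0 < t := fun t ht => hs.trans_le ht.1
  have hz : (0 : ℝ) ∉ Set.uIcc s r := by
    rw [Set.uIcc_of_le hsr]; exact fun h => lt_irrefl _ (hpos 0 h)
  have hinv : ContinuousOn (fun t : ℝ => t⁻¹) (Set.Icc s r) :=
    continuousOn_inv₀.mono fun t ht => (hpos t ht).ne'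
  have h := sq_intervalIntegral_mul_le hsr (w := fun t => t) (u := deriv (profile φ))
    (v := fun t => t⁻¹) continuousOn_id φ.continuous_deriv_profile.continuousOn hinv
    (fun t ht => (hpos t ht).le)
  have e1 : ∫ t in s..r, t * (deriv (profile φ) t * t⁻¹) = profile φ r - profile φ s := by
    rw [← intervalIntegral.integral_deriv_eq_sub
      (fun t _ => (φ.hasDerivAt_profile t).differentiableAt)
      (φ.continuous_deriv_profile.intervalIntegrable _ _)]
    refine intervalIntegral.integral_congr fun t ht => ?_
    have : t ≠ 0 := fun h => hz (h ▸ ht)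
    field_simp
  have e2 : ∫ t in s..r, t * t⁻¹ ^ 2 = Real.log (r / s) := by
    rw [← integral_inv hz]
    refine intervalIntegral.integral_congr fun t ht => ?_
    have : t ≠ 0 := fun h => hz (h ▸ ht)
    field_simp
  rw [e1, e2] at h
  refine h.trans (mul_le_mul_of_nonneg_right (φ.intervalIntegral_deriv_profile_sq_le hs hsr) ?_)
  exact Real.log_nonneg ((one_le_div hs).2 hsr)

theorem abs_profile_sub_le (φ : RadialTest) {s r : ℝ} (hs : 0 < s) (hsr : s ≤ r) :
    |profile φ r - profile φ s| ≤ ‖φ‖ * √(Real.log (r / s)) := by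
  rw [← Real.sqrt_sq (norm_nonneg φ), ← Real.sqrt_mul (sq_nonneg _)]
  exact Real.abs_le_sqrt (φ.sq_profile_sub_le hs hsr)

end RadialTest

/-! ### Pointwise bounds for profiles, and `L^q` bounds near the origin and at infinity -/

namespace RadialTest

theorem exists_profile_eq_zero (φ : RadialTest) (r : ℝ) : ∃ M, r ≤ M ∧ profile φ M = 0 := by
  obtain ⟨R, hR⟩ := φ.hasCompactSupport_profile.isCompact.isBounded.subset_closedBall (0 : ℝ)
  refine ⟨max r (R + 1), le_max_left _ _, ?_⟩
  by_contra h
  have h1 := hR (subset_tsupport _ (show max r (R + 1) ∈ Function.support (profile φ) from h))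
  rw [Metric.mem_closedBall, dist_zero_right] at h1
  have := (le_abs_self (max r (R + 1))).trans h1
  linarith [le_max_right r (R + 1)]

/-- The decay estimate `|f(r)| ≤ C r^{-1/3}`. As `f` vanishes far out, `|f(r)|³` is at most
`3 ∫_r^∞ f² |f'| dt`, and `r ≤ t` turns `r` times this into an integral with the weight `t`, to which
Cauchy–Schwarz applies. -/
theorem mul_abs_profile_pow_three_le (φ : RadialTest) {r : ℝ} (hr : 0 < r) :
    r * |profile φ r| ^ 3 ≤ 3 * ‖φ‖ ^ 3 := by
  obtain ⟨M, hrM, hM⟩ := φ.exists_profile_eq_zero r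
  have cf := φ.contDiff_profile.continuous
  have cd := φ.continuous_deriv_profile
  have hCS := sq_intervalIntegral_mul_le hrM (w := fun t => t)
    (u := fun t => |deriv (profile φ) t|) (v := fun t => profile φ t ^ 2) continuousOn_id
    cd.abs.continuousOn (cf.pow 2).continuousOn (fun t ht => hr.le.trans ht.1)
  have e1 : ∫ t in r..M, t * |deriv (profile φ) t| ^ 2 ≤ ‖φ‖ ^ 2 := by
    simpa only [sq_abs] using φ.intervalIntegral_deriv_profile_sq_le hr hrM
  have e2 : ∫ t in r..M, t * (profile φ t ^ 2) ^ 2 ≤ ‖φ‖ ^ 4 := by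
    simpa only [← pow_mul] using φ.intervalIntegral_profile_pow_four_le hr hrM
  have e20 : 0 ≤ ∫ t in r..M, t * (profile φ t ^ 2) ^ 2 :=
    intervalIntegral.integral_nonneg hrM fun t ht =>
      mul_nonneg (hr.le.trans ht.1) (sq_nonneg _)
  have hI : ∫ t in r..M, t * (|deriv (profile φ) t| * profile φ t ^ 2) ≤ ‖φ‖ ^ 3 := by
    refine le_of_sq_le_sq ?_ (by positivity)
    calc _ ≤ _ := hCS
      _ ≤ ‖φ‖ ^ 2 * ‖φ‖ ^ 4 := mul_le_mul e1 e2 e20 (by positivity)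
      _ = (‖φ‖ ^ 3) ^ 2 := by ring
  have hder : ∀ t, HasDerivAt (fun t => profile φ t ^ 3)
      (3 * profile φ t ^ 2 * deriv (profile φ) t) t := fun t => by
    simpa using (φ.hasDerivAt_profile t).fun_pow 3
  have hftc : ∫ t in r..M, 3 * profile φ t ^ 2 * deriv (profile φ) t = -profile φ r ^ 3 := by
    rw [intervalIntegral.integral_eq_sub_of_hasDerivAt (fun t _ => hder t)
      (((continuous_const.mul (cf.pow 2)).mul cd).intervalIntegrable _ _), hM]
    ring
  calc r * |profile φ r| ^ 3
      = r * |∫ t in r..M, 3 * profile φ t ^ 2 * deriv (profile φ) t| := by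
        rw [hftc, abs_neg, abs_pow]
    _ ≤ r * ∫ t in r..M, |3 * profile φ t ^ 2 * deriv (profile φ) t| :=
        mul_le_mul_of_nonneg_left (intervalIntegral.abs_integral_le_integral_abs hrM) hr.le
    _ = ∫ t in r..M, r * |3 * profile φ t ^ 2 * deriv (profile φ) t| :=
        (intervalIntegral.integral_const_mul _ _).symm
    _ ≤ ∫ t in r..M, 3 * (t * (|deriv (profile φ) t| * profile φ t ^ 2)) := by
        refine intervalIntegral.integral_mono_on hrM
          (Continuous.intervalIntegrable (by fun_prop) _ _)
          (Continuous.intervalIntegrable (by fun_prop) _ _) fun t ht => ?_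
        rw [abs_mul, abs_mul, abs_of_nonneg (sq_nonneg (profile φ t)), abs_of_pos three_pos]
        have : 0 ≤ |deriv (profile φ) t| * profile φ t ^ 2 := by positivity
        nlinarith [mul_le_mul_of_nonneg_right ht.1 this]
    _ = 3 * ∫ t in r..M, t * (|deriv (profile φ) t| * profile φ t ^ 2) :=
        intervalIntegral.integral_const_mul _ _
    _ ≤ 3 * ‖φ‖ ^ 3 := by linarith

theorem abs_profile_le (φ : RadialTest) {r : ℝ} (hr : 0 < r) :
    |profile φ r| ≤ (3 / r) ^ (3⁻¹ : ℝ) * ‖φ‖ := by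
  have h3 : ((3 / r) ^ (3⁻¹ : ℝ)) ^ 3 = 3 / r := by
    simpa using Real.rpow_inv_natCast_pow (n := 3) (by positivity : 0 ≤ 3 / r) (by norm_num)
  refine le_of_pow_le_pow_left₀ three_ne_zero (by positivity) ?_
  rw [mul_pow, h3, div_mul_eq_mul_div, le_div_iff₀ hr, mul_comm]
  exact φ.mul_abs_profile_pow_three_le hr

/-- Near the origin the profile grows at most like `√(log (1/r))`, which is weakened here to
`r^{-1/p}`: the `p`-th power of that is integrable at the origin of the plane. -/
theorem abs_profile_le_of_le_one (φ : RadialTest) {p : ℝ} (hp : 0 < p) {r : ℝ} (hr : 0 < r)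
    (hr1 : r ≤ 1) : |profile φ r| ≤ ‖φ‖ * ((2 + √(p / 2)) * r ^ (-p⁻¹)) := by
  have h1 : |profile φ 1| ≤ 2 * ‖φ‖ := by
    refine le_of_pow_le_pow_left₀ three_ne_zero (by positivity) ?_
    have := φ.mul_abs_profile_pow_three_le one_pos
    have h0 : 0 ≤ ‖φ‖ ^ 3 := by positivity
    rw [mul_pow]
    linarith
  have h2 := φ.abs_profile_sub_le hr hr1
  have h3 : √(Real.log (1 / r)) ≤ √(p / 2) * r ^ (-p⁻¹) := by
    have h4 : Real.log (1 / r) ≤ p / 2 * (r ^ (-p⁻¹)) ^ 2 := by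
      have h5 := Real.log_le_rpow_div (x := 1 / r) (by positivity) (ε := 2 * p⁻¹) (by positivity)
      rw [one_div, Real.inv_rpow hr.le, ← Real.rpow_neg hr.le] at h5
      rw [← Real.rpow_natCast, ← Real.rpow_mul hr.le, one_div]
      have e : -(2 * p⁻¹) = -p⁻¹ * ((2 : ℕ) : ℝ) := by push_cast; ring
      rw [e] at h5
      refine h5.trans (le_of_eq ?_)
      field_simp
    calc √(Real.log (1 / r)) ≤ √(p / 2 * (r ^ (-p⁻¹)) ^ 2) := Real.sqrt_le_sqrt h4
      _ = √(p / 2) * r ^ (-p⁻¹) := by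
        rw [Real.sqrt_mul (by positivity), Real.sqrt_sq (by positivity)]
  have h6 : 1 ≤ r ^ (-p⁻¹) :=
    Real.one_le_rpow_of_pos_of_le_one_of_nonpos hr hr1 (by simpa using hp.le)
  have h7 : |profile φ r| ≤ |profile φ 1| + |profile φ 1 - profile φ r| := by
    have := abs_sub_abs_le_abs_sub (profile φ r) (profile φ 1)
    rw [abs_sub_comm] at this
    linarith
  have h8 := mul_le_mul_of_nonneg_left h3 (norm_nonneg φ)
  have h9 := mul_le_mul_of_nonneg_left h6 (norm_nonneg φ)
  nlinarith

end RadialTest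

theorem memLp_norm_rpow_neg_inv {q : ℝ≥0∞} (hq0 : q ≠ 0) (hq : q ≠ ⊤) :
    MemLp (fun x : Plane => ‖x‖ ^ (-q.toReal⁻¹)) q (volume.restrict (Metric.ball 0 1)) := by
  have hp : q.toReal ≠ 0 := (ENNReal.toReal_pos hq0 hq).ne'
  rw [← integrable_norm_rpow_iff (Measurable.aestronglyMeasurable (by fun_prop)) hq0 hq]
  have h : IntegrableOn (fun x : Plane => ‖x‖ ^ (-1 : ℝ)) (Metric.ball 0 1) := by
    rw [integrableOn_fun_norm_addHaar volume (f := fun y => y ^ (-1 : ℝ))]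
    refine (integrableOn_const (μ := volume) (s := Set.Ioo (0 : ℝ) 1) (C := (1 : ℝ))
      (by simp)).congr_fun (fun y hy => ?_) measurableSet_Ioo
    simp [Real.rpow_neg_one, hy.1.ne']
  refine Integrable.congr h (ae_of_all _ fun x => ?_)
  simp only
  rw [Real.norm_of_nonneg (by positivity), ← Real.rpow_mul (norm_nonneg x)]
  congr 1
  field_simp

/-- The `L^q` norm of a fixed function over a ball around the origin tends to `0` with the radius. -/
theorem exists_eLpNorm_ball_le {E : Type*} [NormedAddCommGroup E] {g : Plane → E} {q : ℝ≥0∞}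
    (hq1 : 1 ≤ q) (hq : q ≠ ⊤) (hg : MemLp g q (volume.restrict (Metric.ball 0 1))) {ε : ℝ}
    (hε : 0 < ε) : ∃ ρ, 0 < ρ ∧ ρ < 1 ∧
      eLpNorm g q (volume.restrict (Metric.ball 0 ρ)) ≤ ENNReal.ofReal ε := by
  obtain ⟨δ, hδ, h⟩ := hg.eLpNorm_indicator_le hq1 hq hε
  obtain ⟨ρ, hρ, hρ'⟩ : ∃ ρ, ρ ∈ Set.Ioo (0 : ℝ) 1 ∧ Real.pi * ρ ^ 2 < δ := by
    have h1 : ∀ᶠ ρ in nhdsWithin (0 : ℝ) (Set.Ioi 0), Real.pi * ρ ^ 2 < δ := by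
      refine Filter.Tendsto.eventually_lt_const hδ
        (Filter.Tendsto.mono_left ?_ nhdsWithin_le_nhds)
      exact Continuous.tendsto' (by fun_prop) _ _ (by simp)
    exact (Filter.Eventually.and (Ioo_mem_nhdsGT one_pos) h1).exists
  refine ⟨ρ, hρ.1, hρ.2, ?_⟩
  have hs : Metric.ball (0 : Plane) ρ ⊆ Metric.ball 0 1 := Metric.ball_subset_ball hρ.2.le
  have h2 := h (Metric.ball 0 ρ) measurableSet_ball ?_
  · rwa [eLpNorm_indicator_eq_eLpNorm_restrict measurableSet_ball,
      Measure.restrict_restrict measurableSet_ball, Set.inter_eq_left.2 hs] at h2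
  · refine (Measure.restrict_apply_le _ _).trans ?_
    rw [EuclideanSpace.volume_ball_fin_two, ← ENNReal.ofReal_pow hρ.1.le]
    rw [← ENNReal.ofReal_mul (by positivity)]
    exact ENNReal.ofReal_le_ofReal (by linarith)

/-- Interpolation of `L^q` between `L⁴` and `L^∞`. -/
theorem eLpNorm_le_rpow_mul_eLpNorm_four {α E : Type*} [MeasurableSpace α] {μ : Measure α}
    [NormedAddCommGroup E] {f : α → E} {q : ℝ≥0∞} (hq4 : 4 < q) (hq : q ≠ ⊤) {M : ℝ≥0∞} (hMtop : M ≠ ⊤)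
    (hM : ∀ᵐ x ∂μ, ‖f x‖ₑ ≤ M) :
    eLpNorm f q μ ≤ M ^ (1 - 4 / q.toReal) * eLpNorm f 4 μ ^ (4 / q.toReal) := by
  have hp4 : 4 < q.toReal := by
    simpa using (ENNReal.toReal_lt_toReal (by simp) hq).2 hq4
  have hp : 0 < q.toReal := by linarith
  have h0 : q ≠ 0 := (lt_trans (by simp) hq4).ne'
  rw [eLpNorm_eq_lintegral_rpow_enorm_toReal h0 hq,
    eLpNorm_eq_lintegral_rpow_enorm_toReal (by simp) (by simp : (4 : ℝ≥0∞) ≠ ⊤)]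
  set p := q.toReal
  have h1 : ∫⁻ x, ‖f x‖ₑ ^ p ∂μ ≤ M ^ (p - 4) * ∫⁻ x, ‖f x‖ₑ ^ (4 : ℝ) ∂μ := by
    rw [← lintegral_const_mul' _ _ (ENNReal.rpow_ne_top_of_nonneg (by linarith) hMtop)]
    refine lintegral_mono_ae ?_
    filter_upwards [hM] with x hx
    rw [← sub_add_cancel p 4, ENNReal.rpow_add_of_nonneg _ _ (by linarith) (by norm_num),
      add_sub_cancel_right]
    gcongr
  calc _ ≤ (M ^ (p - 4) * ∫⁻ x, ‖f x‖ₑ ^ (4 : ℝ) ∂μ) ^ (1 / p) := by gcongr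
    _ = _ := by
      rw [ENNReal.mul_rpow_of_nonneg _ _ (by positivity), ← ENNReal.rpow_mul]
      simp only [ENNReal.toReal_ofNat]
      rw [← ENNReal.rpow_mul]
      congr 2 <;> field_simp

namespace RadialTest

theorem eLpNorm_four_le (φ : RadialTest) :
    eLpNorm (toFun φ) 4 (volume : Measure Plane) ≤ ENNReal.ofReal ‖φ‖ :=
  (ENNReal.le_ofReal_iff_toReal_le (φ.memLp 4).2.ne (norm_nonneg _)).2 φ.norm_four_le

/-- Tail estimate: the decay of the profile makes the `L^q` norm outside a large ball small,
uniformly on the unit ball of the norm. The decay `|x|^{-1/3}` alone is in `L^q` at infinity only for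
`q > 6`, hence the interpolation with `L⁴`. -/
theorem eLpNorm_compl_ball_le (φ : RadialTest) {q : ℝ≥0∞} (hq4 : 4 < q) (hq : q ≠ ⊤) {R : ℝ}
    (hR : 0 < R) : eLpNorm (toFun φ) q (volume.restrict (Metric.ball 0 R)ᶜ) ≤
      ENNReal.ofReal ((3 / R) ^ (3⁻¹ : ℝ)) ^ (1 - 4 / q.toReal) * ENNReal.ofReal ‖φ‖ := by
  have hp4 : 4 < q.toReal := by
    simpa using (ENNReal.toReal_lt_toReal (by simp) hq).2 hq4
  have hθ : 0 ≤ 1 - 4 / q.toReal := by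
    rw [sub_nonneg, div_le_one (by linarith)]; exact hp4.le
  have hθ' : 0 ≤ 4 / q.toReal := by positivity
  have hM : ∀ᵐ x ∂(volume.restrict (Metric.ball (0 : Plane) R)ᶜ),
      ‖toFun φ x‖ₑ ≤ ENNReal.ofReal ((3 / R) ^ (3⁻¹ : ℝ) * ‖φ‖) := by
    filter_upwards [ae_restrict_mem measurableSet_ball.compl] with x hx
    have hx' : R ≤ ‖x‖ := by simpa using hx
    rw [Real.enorm_eq_ofReal_abs, ← φ.profile_norm]
    refine ENNReal.ofReal_le_ofReal ((φ.abs_profile_le (hR.trans_le hx')).trans ?_)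
    gcongr
  refine (eLpNorm_le_rpow_mul_eLpNorm_four hq4 hq ENNReal.ofReal_ne_top hM).trans ?_
  have h4 : eLpNorm (toFun φ) 4 (volume.restrict (Metric.ball (0 : Plane) R)ᶜ) ≤
      ENNReal.ofReal ‖φ‖ := (eLpNorm_mono_measure _ Measure.restrict_le_self).trans φ.eLpNorm_four_le
  calc _ ≤ ENNReal.ofReal ((3 / R) ^ (3⁻¹ : ℝ) * ‖φ‖) ^ (1 - 4 / q.toReal) *
        ENNReal.ofReal ‖φ‖ ^ (4 / q.toReal) := by gcongr
    _ = _ := by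
      rw [ENNReal.ofReal_mul (by positivity), ENNReal.mul_rpow_of_nonneg _ _ hθ, mul_assoc,
        ← ENNReal.rpow_add_of_nonneg _ _ hθ hθ', sub_add_cancel, ENNReal.rpow_one]

/-- Core estimate: near the origin a radial test function is dominated by `‖φ‖` times a fixed
function in `L^q`. -/
theorem eLpNorm_ball_le (φ : RadialTest) {q : ℝ≥0∞} (hq0 : q ≠ 0) (hq : q ≠ ⊤) {ρ : ℝ}
    (hρ : ρ ≤ 1) : eLpNorm (toFun φ) q (volume.restrict (Metric.ball 0 ρ)) ≤
      eLpNorm (fun x : Plane => (2 + √(q.toReal / 2)) * ‖x‖ ^ (-q.toReal⁻¹)) q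
        (volume.restrict (Metric.ball 0 ρ)) * ENNReal.ofReal ‖φ‖ := by
  have hp := ENNReal.toReal_pos hq0 hq
  have h : eLpNorm (toFun φ) q (volume.restrict (Metric.ball 0 ρ)) ≤
      eLpNorm (‖φ‖ • fun x : Plane => (2 + √(q.toReal / 2)) * ‖x‖ ^ (-q.toReal⁻¹)) q
        (volume.restrict (Metric.ball 0 ρ)) := by
    refine eLpNorm_mono_ae_real ?_
    filter_upwards [ae_restrict_mem measurableSet_ball,
      ae_restrict_of_ae (Measure.ae_ne volume (0 : Plane))] with x hx hx0
    rw [Real.norm_eq_abs, ← φ.profile_norm]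
    have hx' : ‖x‖ < ρ := by simpa using hx
    exact φ.abs_profile_le_of_le_one hp (norm_pos_iff.2 hx0) (hx'.le.trans hρ)
  refine h.trans (le_of_eq ?_)
  rw [eLpNorm_const_smul, mul_comm, ← ofReal_norm, norm_norm]

end RadialTest

/-! ### The inclusion into `L^q` and its approximation by step functions -/

theorem eLpNorm_le_restrict_add_restrict_compl {α E : Type*} [MeasurableSpace α] {μ : Measure α}
    [NormedAddCommGroup E] {f : α → E} {q : ℝ≥0∞} (hq1 : 1 ≤ q) (hf : AEStronglyMeasurable f μ)
    {s : Set α} (hs : MeasurableSet s) :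
    eLpNorm f q μ ≤ eLpNorm f q (μ.restrict s) + eLpNorm f q (μ.restrict sᶜ) := by
  rw [← eLpNorm_indicator_eq_eLpNorm_restrict hs,
    ← eLpNorm_indicator_eq_eLpNorm_restrict hs.compl]
  nth_rewrite 1 [← Set.indicator_self_add_compl s f]
  exact eLpNorm_add_le (hf.indicator hs) (hf.indicator hs.compl) hq1

namespace RadialTest

theorem exists_eLpNorm_le {q : ℝ≥0∞} (hq4 : 4 < q) (hq : q ≠ ⊤) :
    ∃ C : ℝ, 0 ≤ C ∧ ∀ φ : RadialTest,
      eLpNorm (toFun φ) q (volume : Measure Plane) ≤ ENNReal.ofReal (C * ‖φ‖) := by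
  have h1 : 1 ≤ q := le_trans (by norm_num) hq4.le
  have h0 : q ≠ 0 := (lt_of_lt_of_le one_pos h1).ne'
  -- The core and tail estimates with both radii equal to `1`.
  set A := eLpNorm (fun x : Plane => (2 + √(q.toReal / 2)) * ‖x‖ ^ (-q.toReal⁻¹)) q
    (volume.restrict (Metric.ball 0 1))
  set B := ENNReal.ofReal ((3 / (1 : ℝ)) ^ (3⁻¹ : ℝ)) ^ (1 - 4 / q.toReal)
  have hA : A ≠ ⊤ := ((memLp_norm_rpow_neg_inv h0 hq).const_mul _).2.ne
  have hB : B ≠ ⊤ := (ENNReal.rpow_lt_top_of_nonneg (by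
    have hp4 : 4 < q.toReal := by
      simpa using (ENNReal.toReal_lt_toReal (by simp) hq).2 hq4
    rw [sub_nonneg, div_le_one (by linarith)]; exact hp4.le) ENNReal.ofReal_ne_top).ne
  refine ⟨(A + B).toReal, ENNReal.toReal_nonneg, fun φ => ?_⟩
  rw [ENNReal.ofReal_mul ENNReal.toReal_nonneg, ENNReal.ofReal_toReal (by simp [hA, hB]), add_mul]
  exact (eLpNorm_le_restrict_add_restrict_compl h1 (φ.memLp q).1 measurableSet_ball).trans
    (add_le_add (φ.eLpNorm_ball_le h0 hq le_rfl) (φ.eLpNorm_compl_ball_le hq4 hq one_pos))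

/-- The inclusion of the radial test functions into `L^q(ℝ²)`, as a linear map. -/
noncomputable def inclLqLinear (q : ℝ≥0∞) : RadialTest →ₗ[ℝ] Lp ℝ q (volume : Measure Plane) where
  toFun φ := (φ.memLp q).toLp φ
  map_add' φ ψ := MemLp.toLp_add (φ.memLp q) (ψ.memLp q)
  map_smul' c φ := MemLp.toLp_const_smul c (φ.memLp q)

theorem exists_inclLq {q : ℝ≥0∞} [Fact (1 ≤ q)] (hq4 : 4 < q) (hq : q ≠ ⊤) :
    ∃ j : RadialTest →L[ℝ] Lp ℝ q (volume : Measure Plane), ∀ φ, j φ = (φ.memLp q).toLp φ := by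
  obtain ⟨C, hC, h⟩ := exists_eLpNorm_le hq4 hq
  refine ⟨(inclLqLinear q).mkContinuous C fun φ => ?_, fun φ => rfl⟩
  have e : ‖inclLqLinear q φ‖ = (eLpNorm (toFun φ) q (volume : Measure Plane)).toReal :=
    Lp.norm_toLp _ (φ.memLp q)
  rw [e]
  exact ENNReal.toReal_le_of_le_ofReal (by positivity) (h φ)

/-- Evaluation on the circle of radius `r > 0`, continuous by the decay estimate. -/
noncomputable def profileCLM {r : ℝ} (hr : 0 < r) : RadialTest →L[ℝ] ℝ :=
  LinearMap.mkContinuous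
    { toFun := fun φ => profile φ r
      map_add' := fun φ ψ => profile_add φ ψ r
      map_smul' := fun c φ => profile_smul c φ r } ((3 / r) ^ (3⁻¹ : ℝ)) fun φ => φ.abs_profile_le hr

/-- The part in `ρ ≤ |x| < R` of the `i`-th geometric shell `ρ e^{δ i} ≤ |x| < ρ e^{δ (i + 1)}`. The
shells are described as the level sets of a floor function, which makes them disjoint by definition. -/
def shell (ρ R δ : ℝ) (i : ℕ) : Set Plane :=
  {x | x ∈ Metric.ball 0 R \ Metric.ball 0 ρ ∧ ⌊Real.log (‖x‖ / ρ) / δ⌋₊ = i}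

theorem measurableSet_shell (ρ R δ : ℝ) (i : ℕ) : MeasurableSet (shell ρ R δ i) := by
  refine (measurableSet_ball.diff measurableSet_ball).inter ?_
  exact measurableSet_eq_fun (Nat.measurable_floor.comp (by fun_prop)) measurable_const

theorem measure_shell_ne_top (ρ R δ : ℝ) (i : ℕ) : volume (shell ρ R δ i) ≠ ⊤ :=
  ((measure_mono fun _ hx => hx.1.1).trans_lt (measure_ball_lt_top (x := 0) (r := R))).ne

theorem abs_sub_profile_le_of_mem_shell (φ : RadialTest) {ρ R δ : ℝ} (hρ : 0 < ρ) (hδ : 0 < δ)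
    {i : ℕ} {x : Plane} (hx : x ∈ shell ρ R δ i) :
    |φ x - profile φ (ρ * Real.exp (δ * i))| ≤ ‖φ‖ * √δ := by
  have h1 : ρ ≤ ‖x‖ := by simpa using hx.1.2
  have hx0 : 0 < ‖x‖ := hρ.trans_le h1
  have h2 : 0 ≤ Real.log (‖x‖ / ρ) / δ :=
    div_nonneg (Real.log_nonneg ((one_le_div hρ).2 h1)) hδ.le
  have h3 := Nat.floor_le h2
  have h4 := Nat.lt_floor_add_one (Real.log (‖x‖ / ρ) / δ)
  rw [hx.2, le_div_iff₀ hδ, Real.log_div hx0.ne' hρ.ne'] at h3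
  rw [hx.2, div_lt_iff₀ hδ, Real.log_div hx0.ne' hρ.ne'] at h4
  have h5 : ρ * Real.exp (δ * i) ≤ ‖x‖ := by
    rw [← Real.log_le_log_iff (by positivity) hx0, Real.log_mul hρ.ne' (Real.exp_ne_zero _),
      Real.log_exp]
    linarith
  rw [← φ.profile_norm]
  refine (φ.abs_profile_sub_le (by positivity) h5).trans ?_
  gcongr
  rw [Real.log_div hx0.ne' (by positivity), Real.log_mul hρ.ne' (Real.exp_ne_zero _),
    Real.log_exp]
  linarith

/-- The step function that replaces `φ`, on each of the first `n` shells, by its value on the inner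
circle of the full shell, and is `0` elsewhere. -/
noncomputable def stepApprox (φ : RadialTest) (ρ R δ : ℝ) (n : ℕ) (x : Plane) : ℝ :=
  ∑ i : Fin n, (shell ρ R δ i).indicator (fun _ => profile φ (ρ * Real.exp (δ * (i : ℕ)))) x

theorem stepApprox_eq_zero (φ : RadialTest) {ρ R : ℝ} (δ : ℝ) (n : ℕ) {x : Plane}
    (hx : x ∉ Metric.ball 0 R \ Metric.ball 0 ρ) : stepApprox φ ρ R δ n x = 0 :=
  Finset.sum_eq_zero fun _ _ => Set.indicator_of_notMem (fun h => hx h.1) _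

theorem abs_sub_stepApprox_le (φ : RadialTest) {ρ R δ : ℝ} (hρ : 0 < ρ) (hδ : 0 < δ)
    {n : ℕ} (hn : Real.log (R / ρ) / δ < n) {x : Plane}
    (hx : x ∈ Metric.ball 0 R \ Metric.ball 0 ρ) :
    |φ x - stepApprox φ ρ R δ n x| ≤ ‖φ‖ * √δ := by
  have h1 : ρ ≤ ‖x‖ := by simpa using hx.2
  have h2 : ‖x‖ < R := by simpa using hx.1
  have hx0 : 0 < ‖x‖ := hρ.trans_le h1
  have hlt : ⌊Real.log (‖x‖ / ρ) / δ⌋₊ < n := by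
    rw [Nat.floor_lt (div_nonneg (Real.log_nonneg ((one_le_div hρ).2 h1)) hδ.le)]
    refine lt_of_le_of_lt ?_ hn
    gcongr
  have hmem : x ∈ shell ρ R δ (⟨_, hlt⟩ : Fin n) := ⟨hx, rfl⟩
  have hs : stepApprox φ ρ R δ n x =
      profile φ (ρ * Real.exp (δ * ((⟨_, hlt⟩ : Fin n) : ℕ))) := by
    rw [stepApprox, Finset.sum_eq_single (⟨_, hlt⟩ : Fin n), Set.indicator_of_mem hmem]
    · intro j _ hj
      exact Set.indicator_of_notMem (fun h => hj (Fin.ext h.2.symm)) _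
    · simp
  rw [hs]
  exact φ.abs_sub_profile_le_of_mem_shell hρ hδ hmem

theorem measurable_stepApprox (φ : RadialTest) (ρ R δ : ℝ) (n : ℕ) :
    Measurable (stepApprox φ ρ R δ n) :=
  Finset.measurable_fun_sum _ fun _ _ => measurable_const.indicator (measurableSet_shell _ _ _ _)

theorem eLpNorm_sub_stepApprox_le (φ : RadialTest) {q : ℝ≥0∞} (hq1 : 1 ≤ q) {ρ R δ : ℝ}
    (hρ : 0 < ρ) (hρR : ρ ≤ R) (hδ : 0 < δ) {n : ℕ} (hn : Real.log (R / ρ) / δ < n) :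
    eLpNorm (fun x => φ x - stepApprox φ ρ R δ n x) q (volume : Measure Plane) ≤
      eLpNorm (toFun φ) q (volume.restrict (Metric.ball 0 ρ)) +
      volume (Metric.ball (0 : Plane) R) ^ q.toReal⁻¹ * ENNReal.ofReal (‖φ‖ * √δ) +
      eLpNorm (toFun φ) q (volume.restrict (Metric.ball 0 R)ᶜ) := by
  have hm : ∀ μ : Measure Plane,
      AEStronglyMeasurable (fun x => φ x - stepApprox φ ρ R δ n x) μ := fun μ =>
    (φ.contDiff.continuous.measurable.sub
      (φ.measurable_stepApprox ρ R δ n)).aestronglyMeasurable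
  refine (eLpNorm_le_restrict_add_restrict_compl hq1 (hm _)
    (measurableSet_ball (x := 0) (ε := R))).trans (add_le_add ?_ ?_)
  · refine (eLpNorm_le_restrict_add_restrict_compl hq1 (hm _)
      (measurableSet_ball (x := 0) (ε := ρ))).trans (add_le_add ?_ ?_)
    · rw [Measure.restrict_restrict measurableSet_ball,
        Set.inter_eq_left.2 (Metric.ball_subset_ball hρR)]
      refine eLpNorm_mono_ae ?_
      filter_upwards [ae_restrict_mem measurableSet_ball] with x hx
      rw [φ.stepApprox_eq_zero δ n fun h => h.2 hx, sub_zero]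
    · rw [Measure.restrict_restrict measurableSet_ball.compl]
      refine (eLpNorm_le_of_ae_bound (C := ‖φ‖ * √δ) ?_).trans ?_
      · filter_upwards [ae_restrict_mem (measurableSet_ball.compl.inter measurableSet_ball)]
          with x hx
        exact φ.abs_sub_stepApprox_le hρ hδ hn ⟨hx.2, hx.1⟩
      · rw [Measure.restrict_apply_univ]
        gcongr
        exact Set.inter_subset_right
  · refine eLpNorm_mono_ae ?_
    filter_upwards [ae_restrict_mem measurableSet_ball.compl] with x hx
    rw [φ.stepApprox_eq_zero δ n fun h => hx h.1, sub_zero]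

/-- The step functions approximate the radial test functions in `L^q`, with one choice of the shells
for the whole unit ball. -/
theorem exists_stepApprox {q : ℝ≥0∞} (hq4 : 4 < q) (hq : q ≠ ⊤) {ε : ℝ} (hε : 0 < ε) :
    ∃ (ρ R δ : ℝ) (n : ℕ), 0 < ρ ∧ ∀ φ : RadialTest,
      eLpNorm (fun x => φ x - stepApprox φ ρ R δ n x) q (volume : Measure Plane) ≤
        ENNReal.ofReal (ε * ‖φ‖) := by
  have h1 : 1 ≤ q := le_trans (by norm_num) hq4.le
  have h0 : q ≠ 0 := (lt_of_lt_of_le one_pos h1).ne'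
  have hp4 : 4 < q.toReal := by
    simpa using (ENNReal.toReal_lt_toReal (by simp) hq).2 hq4
  have hθ : 0 < 1 - 4 / q.toReal := by
    rw [sub_pos, div_lt_one (by linarith)]; exact hp4
  have hε3 : 0 < ε / 3 := by positivity
  obtain ⟨ρ, hρ, hρ1, hcore⟩ := exists_eLpNorm_ball_le h1 hq
    ((memLp_norm_rpow_neg_inv h0 hq).const_mul (2 + √(q.toReal / 2))) hε3
  obtain ⟨R, hR1, htail⟩ : ∃ R : ℝ, 1 ≤ R ∧
      ENNReal.ofReal ((3 / R) ^ (3⁻¹ : ℝ)) ^ (1 - 4 / q.toReal) ≤ ENNReal.ofReal (ε / 3) := by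
    have ht : Filter.Tendsto (fun R : ℝ => ENNReal.ofReal ((3 / R) ^ (3⁻¹ : ℝ)) ^
        (1 - 4 / q.toReal)) Filter.atTop (nhds 0) := by
      have ha : Filter.Tendsto (fun R : ℝ => (3 / R) ^ (3⁻¹ : ℝ)) Filter.atTop (nhds 0) := by
        have := (Filter.Tendsto.const_div_atTop Filter.tendsto_id (3 : ℝ)).rpow_const
          (p := (3⁻¹ : ℝ)) (Or.inr (by norm_num))
        simpa using this
      have hb := ((ENNReal.continuous_rpow_const (y := 1 - 4 / q.toReal)).tendsto _).comp
        (ENNReal.tendsto_ofReal ha)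
      simpa [ENNReal.zero_rpow_of_pos hθ, Function.comp_def] using hb
    have he := ht.eventually_le_const (ENNReal.ofReal_pos.2 hε3)
    exact ((Filter.eventually_ge_atTop 1).and he).exists
  set V := volume (Metric.ball (0 : Plane) R) ^ q.toReal⁻¹ with hV
  have hVtop : V ≠ ⊤ :=
    (ENNReal.rpow_lt_top_of_nonneg (by positivity) measure_ball_lt_top.ne).ne
  -- Functions in the unit ball oscillate by at most `√δ` on each shell, and `V √δ ≤ ε / 3`.
  have hd : 0 < ε / 3 / (V.toReal + 1) := by positivity
  set δ := (ε / 3 / (V.toReal + 1)) ^ 2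
  have hδ : 0 < δ := by positivity
  obtain ⟨n, hn⟩ := exists_nat_gt (Real.log (R / ρ) / δ)
  refine ⟨ρ, R, δ, n, hρ, fun φ => ?_⟩
  refine (φ.eLpNorm_sub_stepApprox_le h1 hρ (hρ1.le.trans hR1) hδ hn).trans ?_
  have e1 : eLpNorm (toFun φ) q (volume.restrict (Metric.ball 0 ρ)) ≤
      ENNReal.ofReal (ε / 3 * ‖φ‖) := by
    rw [ENNReal.ofReal_mul hε3.le]
    exact (φ.eLpNorm_ball_le h0 hq hρ1.le).trans (by gcongr)
  have e3 : eLpNorm (toFun φ) q (volume.restrict (Metric.ball 0 R)ᶜ) ≤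
      ENNReal.ofReal (ε / 3 * ‖φ‖) := by
    rw [ENNReal.ofReal_mul hε3.le]
    exact (φ.eLpNorm_compl_ball_le hq4 hq (by linarith)).trans (by gcongr)
  have e2 : V * ENNReal.ofReal (‖φ‖ * √δ) ≤ ENNReal.ofReal (ε / 3 * ‖φ‖) := by
    rw [← ENNReal.ofReal_toReal hVtop, ← ENNReal.ofReal_mul ENNReal.toReal_nonneg]
    refine ENNReal.ofReal_le_ofReal ?_
    rw [Real.sqrt_sq hd.le]
    have h2 : V.toReal * (ε / 3 / (V.toReal + 1)) ≤ ε / 3 := by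
      rw [mul_div_assoc', div_le_iff₀ (by positivity)]
      nlinarith [ENNReal.toReal_nonneg (a := V)]
    calc _ = V.toReal * (ε / 3 / (V.toReal + 1)) * ‖φ‖ := by ring
      _ ≤ _ := by gcongr
  refine (add_le_add (add_le_add e1 e2) e3).trans (le_of_eq ?_)
  rw [← ENNReal.ofReal_add (by positivity) (by positivity),
    ← ENNReal.ofReal_add (by positivity) (by positivity)]
  congr 1
  ring

/-- The inclusion of the radial test functions into `L^q` is a limit, in operator norm, of maps that
factor through a finite-dimensional space: sample `φ` at finitely many radii and form the step
function. -/
theorem exists_finiteDim_approx {q : ℝ≥0∞} [Fact (1 ≤ q)] (hq4 : 4 < q) (hq : q ≠ ⊤) {ε : ℝ}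
    (hε : 0 < ε) : ∃ (n : ℕ) (S : RadialTest →L[ℝ] (Fin n → ℝ))
      (J : (Fin n → ℝ) →L[ℝ] Lp ℝ q (volume : Measure Plane)),
      ∀ φ : RadialTest, ‖(φ.memLp q).toLp φ - J (S φ)‖ ≤ ε * ‖φ‖ := by
  obtain ⟨ρ, R, δ, n, hρ, h⟩ := exists_stepApprox hq4 hq hε
  let v : Fin n → Lp ℝ q (volume : Measure Plane) := fun i =>
    indicatorConstLp q (measurableSet_shell ρ R δ i) (measure_shell_ne_top ρ R δ i) (1 : ℝ)
  refine ⟨n, ContinuousLinearMap.pi fun i : Fin n =>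
    profileCLM (r := ρ * Real.exp (δ * (i : ℕ))) (by positivity),
    LinearMap.toContinuousLinearMap (Fintype.linearCombination ℝ v), fun φ => ?_⟩
  rw [Lp.norm_def]
  refine ENNReal.toReal_le_of_le_ofReal (by positivity) (le_of_eq_of_le ?_ (h φ))
  refine eLpNorm_congr_ae ?_
  have hsum : (Fintype.linearCombination ℝ v
      (fun i : Fin n => profile φ (ρ * Real.exp (δ * (i : ℕ)))) : Lp ℝ q (volume : Measure Plane))
      =ᵐ[volume] stepApprox φ ρ R δ n := by
    rw [Fintype.linearCombination_apply]
    have hi : ∀ᵐ x, ∀ i : Fin n, (profile φ (ρ * Real.exp (δ * (i : ℕ))) • v i :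
        Lp ℝ q (volume : Measure Plane)) x =
        (shell ρ R δ i).indicator (fun _ => profile φ (ρ * Real.exp (δ * (i : ℕ)))) x := by
      refine ae_all_iff.2 fun i => ?_
      filter_upwards [Lp.coeFn_smul (profile φ (ρ * Real.exp (δ * (i : ℕ)))) (v i),
        indicatorConstLp_coeFn (p := q) (hs := measurableSet_shell ρ R δ i)
          (hμs := measure_shell_ne_top ρ R δ i) (c := (1 : ℝ))] with x hx1 hx2
      rw [hx1, Pi.smul_apply, hx2]
      by_cases hx : x ∈ shell ρ R δ i <;> simp [hx]
    filter_upwards [Lp.coeFn_finsetSum Finset.univ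
      (fun i : Fin n => profile φ (ρ * Real.exp (δ * (i : ℕ))) • v i), hi] with x hx1 hx2
    rw [hx1, Finset.sum_apply, stepApprox]
    exact Finset.sum_congr rfl fun i _ => hx2 i
  filter_upwards [Lp.coeFn_sub ((φ.memLp q).toLp φ) (Fintype.linearCombination ℝ v
      (fun i : Fin n => profile φ (ρ * Real.exp (δ * (i : ℕ))))), (φ.memLp q).coeFn_toLp,
    hsum] with x hx1 hx2 hx3
  refine hx1.trans ?_
  rw [Pi.sub_apply, hx2, hx3]

end RadialTest

/-! ### Gradients and integration by parts -/

theorem continuous_gradient_of_contDiff {ψ : Plane → ℝ} (hψ : ContDiff ℝ ∞ ψ) :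
    Continuous (∇ ψ) :=
  (InnerProductSpace.toDual ℝ Plane).symm.continuous.comp (hψ.continuous_fderiv (by simp))

theorem hasCompactSupport_gradient {ψ : Plane → ℝ} (hs : HasCompactSupport ψ) :
    HasCompactSupport (∇ ψ) :=
  (hs.fderiv (𝕜 := ℝ)).comp_left (g := (InnerProductSpace.toDual ℝ Plane).symm) (map_zero _)

theorem inner_gradient_eq_fderiv (ψ : Plane → ℝ) (v x : Plane) :
    inner ℝ v (∇ ψ x) = fderiv ℝ ψ x v := by
  rw [real_inner_comm, gradient, InnerProductSpace.toDual_symm_apply]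

theorem integral_smul_gradient_eq_neg {ψ φ : Plane → ℝ} (hψ : ContDiff ℝ ∞ ψ)
    (hψs : HasCompactSupport ψ) (hφ : ContDiff ℝ ∞ φ) :
    ∫ x, ψ x • ∇ φ x = -∫ x, φ x • ∇ ψ x := by
  have cψ := hψ.continuous
  have cφ := hφ.continuous
  have gψ := continuous_gradient_of_contDiff hψ
  have gφ := continuous_gradient_of_contDiff hφ
  have dψ := hψ.continuous_fderiv (by simp)
  have dφ := hφ.continuous_fderiv (by simp)
  have i1 : Integrable (fun x => ψ x • ∇ φ x) :=
    (cψ.smul gφ).integrable_of_hasCompactSupport hψs.smul_right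
  have i2 : Integrable (fun x => φ x • ∇ ψ x) :=
    (cφ.smul gψ).integrable_of_hasCompactSupport (hasCompactSupport_gradient hψs).smul_left
  refine ext_inner_left ℝ fun v => ?_
  rw [inner_neg_right, ← integral_inner i1, ← integral_inner i2]
  simp only [inner_smul_right, inner_gradient_eq_fderiv]
  rw [integral_mul_fderiv_eq_neg_fderiv_mul_of_integrable]
  · simp only [mul_comm]
  · refine Continuous.integrable_of_hasCompactSupport (by fun_prop) ?_
    exact (hψs.fderiv_apply (𝕜 := ℝ) v).mul_right
  · exact Continuous.integrable_of_hasCompactSupport (by fun_prop) hψs.mul_right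
  · exact (cψ.mul cφ).integrable_of_hasCompactSupport hψs.mul_right
  · exact fun x _ => hψ.differentiable (by simp) x
  · exact fun x _ => hφ.differentiable (by simp) x

/-! ### The extension to the completion -/

namespace RadialTest

/-- The gradient as a linear map from the radial test functions to `L²(ℝ²)`. -/
noncomputable def gradL2Linear : RadialTest →ₗ[ℝ] Lp Plane 2 (volume : Measure Plane) where
  toFun φ := (φ.memLp_gradient 2).toLp (∇ (toFun φ))
  map_add' φ ψ := by
    rw [← MemLp.toLp_add]
    exact MemLp.toLp_congr _ _ (by rw [gradient_add])
  map_smul' c φ := by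
    rw [RingHom.id_apply, ← MemLp.toLp_const_smul]
    exact MemLp.toLp_congr _ _ (by rw [gradient_smul])

theorem norm_gradL2Linear (φ : RadialTest) : ‖gradL2Linear φ‖ =
    (eLpNorm (∇ (toFun φ)) 2 (volume : Measure Plane)).toReal :=
  Lp.norm_toLp _ (φ.memLp_gradient 2)

/-- The gradient as a continuous linear map from the radial test functions to `L²(ℝ²)`. -/
noncomputable def gradL2 : RadialTest →L[ℝ] Lp Plane 2 (volume : Measure Plane) :=
  gradL2Linear.mkContinuous 1 fun φ => by
    rw [one_mul, norm_gradL2Linear]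
    exact φ.norm_gradient_le

end RadialTest

namespace RadialH24

/-- The continuous extension of a continuous linear map to the completion. -/
noncomputable def extend {F : Type*} [NormedAddCommGroup F] [NormedSpace ℝ F] [CompleteSpace F]
    (f : RadialTest →L[ℝ] F) : RadialH24 →L[ℝ] F :=
  f.extend UniformSpace.Completion.toComplL

theorem extend_coe {F : Type*} [NormedAddCommGroup F] [NormedSpace ℝ F] [CompleteSpace F]
    (f : RadialTest →L[ℝ] F) (φ : RadialTest) : extend f (φ : RadialH24) = f φ :=
  ContinuousLinearMap.extend_eq f
    (e := (UniformSpace.Completion.toComplL : RadialTest →L[ℝ] RadialH24))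
    UniformSpace.Completion.denseRange_coe
    (UniformSpace.Completion.isUniformInducing_coe RadialTest) φ

theorem norm_eq (u : RadialH24) : ‖u‖ = ‖extend RadialTest.gradL2 u‖ + ‖toL4 u‖ := by
  induction u using UniformSpace.Completion.induction_on with
  | hp => exact isClosed_eq (by fun_prop) (by fun_prop)
  | ih φ =>
    rw [extend_coe, toL4_coe, UniformSpace.Completion.norm_coe, RadialTest.norm_def,
      Lp.norm_toLp]
    congr 1
    exact (RadialTest.norm_gradL2Linear φ).symm

/-- The `L²` limit of the gradients is the weak gradient of the `L⁴` limit: for a fixed test function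
both sides are continuous in `u`, and on test functions they agree by integration by parts. -/
theorem integral_smul_gradL2_eq_neg (u : RadialH24) {ψ : Plane → ℝ} (hψ : ContDiff ℝ ∞ ψ)
    (hψs : HasCompactSupport ψ) :
    ∫ x, ψ x • extend RadialTest.gradL2 u x = -∫ x, toL4 u x • ∇ ψ x := by
  have hψ2 : MemLp ψ 2 (volume : Measure Plane) :=
    hψ.continuous.memLp_of_hasCompactSupport hψs
  have hgψ : MemLp (∇ ψ) (ENNReal.conjExponent 4) (volume : Measure Plane) :=
    (continuous_gradient_of_contDiff hψ).memLp_of_hasCompactSupport (hasCompactSupport_gradient hψs)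
  have : Fact (1 ≤ ENNReal.conjExponent 4) :=
    ⟨ENNReal.HolderConjugate.one_le (ENNReal.conjExponent 4) 4⟩
  let B : ℝ →L[ℝ] Plane →L[ℝ] Plane := ContinuousLinearMap.lsmul ℝ ℝ
  have h1 : ∀ G : Lp Plane 2 (volume : Measure Plane),
      B.lpPairing volume 2 2 (hψ2.toLp ψ) G = ∫ x, ψ x • G x := fun G => by
    rw [ContinuousLinearMap.lpPairing_eq_integral]
    refine integral_congr_ae ?_
    filter_upwards [hψ2.coeFn_toLp] with x hx
    rw [hx]; rfl
  have h2 : ∀ g : Lp ℝ 4 (volume : Measure Plane),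
      (B.lpPairing volume 4 (ENNReal.conjExponent 4)).flip (hgψ.toLp _) g = ∫ x, g x • ∇ ψ x :=
    fun g => by
    rw [ContinuousLinearMap.flip_apply, ContinuousLinearMap.lpPairing_eq_integral]
    refine integral_congr_ae ?_
    filter_upwards [hgψ.coeFn_toLp] with x hx
    rw [hx]; rfl
  rw [← h1, ← h2]
  induction u using UniformSpace.Completion.induction_on with
  | hp => exact isClosed_eq (by fun_prop) (by fun_prop)
  | ih φ =>
    rw [extend_coe, toL4_coe, h1, h2]
    have e1 : ∫ x, ψ x • RadialTest.gradL2 φ x = ∫ x, ψ x • ∇ φ.toFun x := by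
      refine integral_congr_ae ?_
      filter_upwards [(φ.memLp_gradient 2).coeFn_toLp] with x hx
      exact congrArg (ψ x • ·) hx
    have e2 : ∫ x, (φ.memLp 4).toLp φ x • ∇ ψ x = ∫ x, φ x • ∇ ψ x := by
      refine integral_congr_ae ?_
      filter_upwards [(φ.memLp 4).coeFn_toLp] with x hx
      rw [hx]
    rw [e1, e2]
    exact integral_smul_gradient_eq_neg hψ hψs φ.contDiff

/-- An element of the completion is determined by the function it represents. If the function is `0`,
then so is its weak gradient, which is the limit of the gradients. -/
theorem toL4_injective : Function.Injective toL4 := by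
  rw [injective_iff_map_eq_zero]
  intro u hu
  have hD : extend RadialTest.gradL2 u = 0 := by
    rw [Lp.eq_zero_iff_ae_eq_zero]
    refine ae_eq_zero_of_integral_contDiff_smul_eq_zero
      ((Lp.memLp _).locallyIntegrable (by norm_num)) fun ψ hψ hψs => ?_
    rw [integral_smul_gradL2_eq_neg u hψ hψs, hu, neg_eq_zero]
    simp
  rw [← norm_eq_zero, norm_eq, hD, hu, norm_zero, norm_zero, add_zero]

/-- A continuous extension to the completion of the inclusion into `L^q` represents the same function
as the one into `L⁴`: limits in `L^q` and in `L⁴` are limits in measure, which are unique. -/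
theorem ae_eq_toL4 {q : ℝ≥0∞} [Fact (1 ≤ q)]
    {ι : RadialH24 →L[ℝ] Lp ℝ q (volume : Measure Plane)}
    (hι : ∀ φ : RadialTest, ι (φ : RadialH24) = (φ.memLp q).toLp φ) (u : RadialH24) :
    (ι u : Plane → ℝ) =ᵐ[volume] (toL4 u : Plane → ℝ) := by
  obtain ⟨s, hs, hsu⟩ := mem_closure_iff_seq_limit.1
    (UniformSpace.Completion.denseRange_coe (α := RadialTest) u)
  choose φ hφ using hs
  obtain rfl : (fun n => (φ n : RadialH24)) = s := funext hφ
  have h1 := tendstoInMeasure_of_tendsto_Lp ((ι.continuous.tendsto u).comp hsu)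
  have h2 := tendstoInMeasure_of_tendsto_Lp ((toL4.continuous.tendsto u).comp hsu)
  refine tendstoInMeasure_ae_unique h1 (h2.congr_left fun n => ?_)
  simp only [Function.comp_apply, hι, toL4_coe]
  exact ((φ n).memLp 4).coeFn_toLp.trans ((φ n).memLp q).coeFn_toLp.symm

theorem isCompactOperator_of_coe {q : ℝ≥0∞} [Fact (1 ≤ q)] (hq4 : 4 < q) (hq : q ≠ ⊤)
    {ι : RadialH24 →L[ℝ] Lp ℝ q (volume : Measure Plane)}
    (hι : ∀ φ : RadialTest, ι (φ : RadialH24) = (φ.memLp q).toLp φ) : IsCompactOperator ι := by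
  have hcl := isClosed_setOfPred_isCompactOperator (𝕜₁ := ℝ) (𝕜₂ := ℝ) (σ₁₂ := RingHom.id ℝ)
    (M₁ := RadialH24) (M₂ := Lp ℝ q (volume : Measure Plane))
  refine hcl.closure_subset (Metric.mem_closure_iff.2 fun ε hε => ?_)
  obtain ⟨n, S, J, h⟩ := RadialTest.exists_finiteDim_approx hq4 hq (half_pos hε)
  refine ⟨J ∘L extend S, ?_, ?_⟩
  · exact (isCompactOperator_of_locallyCompactSpace_rng J).comp_clm (extend S)
  · rw [dist_eq_norm]
    refine lt_of_le_of_lt (ContinuousLinearMap.opNorm_le_bound _ (half_pos hε).le fun u => ?_)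
      (half_lt_self hε)
    induction u using UniformSpace.Completion.induction_on with
    | hp => exact isClosed_le (by fun_prop) (by fun_prop)
    | ih φ =>
      simpa [extend_coe, hι] using h φ

end RadialH24

theorem proposition2p7 (q : ℝ≥0∞) [Fact (1 ≤ q)] (hq4 : 4 < q) (hq : q < ⊤) :
    ∃ ι : RadialH24 →L[ℝ] Lp ℝ q (volume : Measure Plane),
      (∀ φ : RadialTest, ι (φ : RadialH24) = (φ.memLp q).toLp φ) ∧
      (∀ u : RadialH24, (ι u : Plane → ℝ) =ᵐ[volume] (RadialH24.toL4 u : Plane → ℝ)) ∧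
      Function.Injective ι ∧
      IsCompactOperator ι := by
  obtain ⟨j, hj⟩ := RadialTest.exists_inclLq hq4 hq.ne
  have hι : ∀ φ : RadialTest, RadialH24.extend j (φ : RadialH24) = (φ.memLp q).toLp φ :=
    fun φ => (RadialH24.extend_coe j φ).trans (hj φ)
  refine ⟨RadialH24.extend j, hι, RadialH24.ae_eq_toL4 hι, fun u v huv => ?_,
    RadialH24.isCompactOperator_of_coe hq4 hq.ne hι⟩
  refine RadialH24.toL4_injective (Lp.ext ?_)
  exact (RadialH24.ae_eq_toL4 hι u).symm.trans (huv ▸ RadialH24.ae_eq_toL4 hι v)
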